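/- **Corollary (Posterior consistency).** Let $\mathfrak X$ be a countable set equipped with the $\sigma$-algebra of all its subsets. For finite measures $Q,Q'$ on $\mathfrak X$ put $\|Q-Q'\|_{\mathrm{Tot.Var.}}:=\sup_{C\subset\mathfrak X}|Q(C)-Q'(C)|$. For a probability measure $\mu$ on $\mathfrak X$ and $m>0$, let $DP(\mu,m)$ denote the Dirichlet process with mean $\mu$ and concentration parameter $m$, i.e. the law of a random probability measure $D$ on $\mathfrak X$ such that, for every finite partition $(A_1,\dots,A_k)$ of $\mathfrak X$, the vector $(D(A_1),\dots,D(A_k))$ has the Dirichlet distribution with parameters $(m\mu(A_1),\dots,m\mu(A_k))$ (coordinates with parameter $0$ being equal to $0$). Sethuraman's representation of it is $D=\sum_{i\ge 0}\beta_i\delta_{Y_i}$, where $\beta_i=V_i\prod_{j<i}(1-V_j)$, the $V_i$ are i.i.d. with law $\mathrm{Beta}(1,m)$, the $Y_i$ are i.i.d. with law $\mu$, and the sequences $(V_i)$ and $(Y_i)$ are independent. Let $\alpha$ and $\mathbf P_0$ be probability measures on $\mathfrak X$ and let $M>0$. For a sequence $(x_i)_{i\ge1}$ in $\mathfrak X$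 and $n\ge 1$ put $$\mathbf P_{(x_1,\dots,x_n)}:=\frac1n\sum_{i=1}^n\delta_{x_i},\qquad \theta_n:=\frac{M}{M+n},\qquad \alpha_{(x_1,\dots,x_n)}:=\theta_n\,\alpha+(1-\theta_n)\,\mathbf P_{(x_1,\dots,x_n)},$$ and let $Post_n(x_1,\dots,x_n)$ be a random probability measure with law $DP(\alpha_{(x_1,\dots,x_n)},M+n)$ (the posterior, given the observations $x_1,\dots,x_n$, for the prior $DP(\alpha,M)$). Then for $\mathbf P_0^{\otimes\mathbb N^*}$-almost every sequence $(x_i)_{i\ge1}$, $$\big\|Post_n(x_1,\dots,x_n)-\mathbf P_{(x_1,\dots,x_n)}\big\|_{\mathrm{Tot.Var.}}\longrightarrow 0\quad\text{in law as } n\to\infty,$$ both for every choice of random probability measures $Post_n(x_1,\dots,x_n)$ with the defining finite-dimensional Dirichlet distributions and for those given by Sethuraman's representation. -/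

import Mathlib

open MeasureTheory ProbabilityTheory Filter
open scoped ENNReal

noncomputable section

namespace DirichletPosterior

variable {X : Type*} [MeasurableSpace X]

/-- Total variation distance `sup_C |Q(C) - Q'(C)|`. It is used on countable spaces in which all
subsets are measurable, so the supremum runs over all subsets. -/
def tvDist (Q Q' : Measure X) : ℝ := ⨆ C : Set X, |Q.real C - Q'.real C|

/-- Empirical measure `n⁻¹ ∑_{i<n} δ_{x i}` of the first `n` observations (zero for `n = 0`). -/
def empirical (x : ℕ → X) (n : ℕ) : Measure X :=
  (n : ℝ≥0∞)⁻¹ • ∑ i ∈ Finset.range n, Measure.dirac (x i)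

/-- `θ_n = M / (M + n)`. -/
def theta (M : ℝ) (n : ℕ) : ℝ := M / (M + n)

/-- Mean of the posterior after `n` observations: `θ_n α + (1 - θ_n) n⁻¹ ∑_{i<n} δ_{x i}`. -/
def posteriorMean (α : Measure X) (M : ℝ) (x : ℕ → X) (n : ℕ) : Measure X :=
  ENNReal.ofReal (theta M n) • α + ENNReal.ofReal (1 - theta M n) • empirical x n

/-- Gamma distribution with shape `a ≥ 0` and rate `1`; it is the point mass at `0` for `a = 0`. -/
def gammaLaw (a : ℝ) : Measure ℝ := if a = 0 then Measure.dirac 0 else gammaMeasure a 1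

/-- Dirichlet distribution with parameters `a i ≥ 0`, not all zero: the law of
`(G_i / ∑ j, G_j)_i` for independent `G_i` with gamma distribution of shape `a i`. -/
def dirichletDist {k : ℕ} (a : Fin k → ℝ) : Measure (Fin k → ℝ) :=
  (Measure.pi fun i => gammaLaw (a i)).map fun g i => g i / ∑ j, g j

/-- `D`, a law on the space of measures on `X`, is the law `DP(α, M)` of a Dirichlet process with
mean `α` and concentration `M`: it is carried by the probability measures, and for each finite
measurable partition `A_1, …, A_k` of `X` the vector `(Q(A_1), …, Q(A_k))`, with `Q` drawn from
`D`, is Dirichlet distributed with parameters `M α(A_1), …, M α(A_k)`. -/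
structure IsDirichletProcess (α : Measure X) (M : ℝ) (D : Measure (Measure X)) : Prop where
  ae_isProbabilityMeasure : ∀ᵐ Q ∂D, IsProbabilityMeasure Q
  map_partition : ∀ (k : ℕ) (A : Fin k → Set X), (∀ i, MeasurableSet (A i)) →
    Pairwise (fun i j => Disjoint (A i) (A j)) → (⋃ i, A i) = Set.univ →
      D.map (fun Q i => Q.real (A i)) = dirichletDist fun i => M * α.real (A i)

/-- Stick-breaking weights `v_i ∏_{j<i} (1 - v_j)`. -/
def stickWeight (v : ℕ → ℝ) (i : ℕ) : ℝ := v i * ∏ j ∈ Finset.range i, (1 - v j)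

/-- The discrete measure `∑_i β_i δ_{y_i}` with stick-breaking weights `β`. -/
def stickMeasure (p : (ℕ → ℝ) × (ℕ → X)) : Measure X :=
  Measure.sum fun i => ENNReal.ofReal (stickWeight p.1 i) • Measure.dirac (p.2 i)

/-- Law of `∑_i β_i δ_{Y_i}`, where `β` are the stick-breaking weights of an i.i.d. sequence
`V_i ∼ Beta(1, M)`, independent of the i.i.d. sequence `Y_i ∼ α`. -/
def stickBreakingLaw (α : Measure X) (M : ℝ) : Measure (Measure X) :=
  ((Measure.infinitePi fun _ : ℕ => betaMeasure 1 M).prod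
    (Measure.infinitePi fun _ : ℕ => α)).map stickMeasure

theorem measurable_stickMeasure : Measurable (stickMeasure (X := X)) := by
  refine Measure.measurable_of_measurable_coe _ fun s hs => ?_
  simp only [stickMeasure, Measure.sum_apply _ hs, Measure.smul_apply, smul_eq_mul,
    Measure.dirac_apply' _ hs]
  refine Measurable.tsum fun i => ?_
  refine Measurable.mul ?_ ?_
  · unfold stickWeight
    fun_prop
  · exact (measurable_one.indicator hs).comp (by fun_prop)

theorem isProbabilityMeasure_stickBreakingLaw (α : Measure X) [IsProbabilityMeasure α] {M : ℝ}
    (hM : 0 < M) : IsProbabilityMeasure (stickBreakingLaw α M) := by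
  have := isProbabilityMeasureBeta one_pos hM
  exact Measure.isProbabilityMeasure_map measurable_stickMeasure.aemeasurable

theorem isProbabilityMeasure_posteriorMean (α : Measure X) [IsProbabilityMeasure α] {M : ℝ}
    (hM : 0 < M) (x : ℕ → X) (n : ℕ) : IsProbabilityMeasure (posteriorMean α M x n) := by
  have hn : (0 : ℝ) ≤ n := n.cast_nonneg
  have h0 : 0 ≤ theta M n := by unfold theta; positivity
  have h1 : theta M n ≤ 1 := by
    unfold theta
    rw [div_le_one (by positivity)]
    linarith
  refine ⟨?_⟩
  rcases Nat.eq_zero_or_pos n with rfl | hpos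
  · simp [posteriorMean, theta, hM.ne']
  · have he : empirical x n Set.univ = 1 := by
      simp [empirical, ENNReal.inv_mul_cancel, hpos.ne']
    simp only [posteriorMean, Measure.add_apply, Measure.smul_apply, he, measure_univ,
      smul_eq_mul, mul_one]
    rw [← ENNReal.ofReal_add h0 (by linarith)]
    simp

/-- The stick-breaking version of the posterior law `DP(α_{x_1,…,x_n}, M + n)`. -/
def stickBreakingPosterior (α : ProbabilityMeasure X) (M : ℝ) (hM : 0 < M) (x : ℕ → X) (n : ℕ) :
    ProbabilityMeasure (Measure X) :=
  ⟨stickBreakingLaw (posteriorMean (α : Measure X) M x n) (M + n),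
    have := isProbabilityMeasure_posteriorMean (α : Measure X) hM x n
    isProbabilityMeasure_stickBreakingLaw _ (by positivity)⟩

/-- For `Q_n` drawn from `Post n`, the total variation distance between `Q_n` and the empirical
measure of the first `n` observations converges in distribution to `0`. -/
def TVTendstoZeroInLaw (x : ℕ → X) (Post : ℕ → ProbabilityMeasure (Measure X)) : Prop :=
  TendstoInDistribution (fun n (Q : Measure X) => tvDist Q (empirical x n)) atTop
    (fun _ : Unit => (0 : ℝ)) (fun n => (Post n : Measure (Measure X))) (Measure.dirac ())

end DirichletPosterior

end

/-!
For both versions of `DP(m, s)` and every measurable `A` one has `E|Q(A) - m(A)| ≤ 2 / √s`. For the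
finite-dimensional Dirichlet distributions this holds because they are normalised vectors of
independent gamma variables, whose variance equals their mean. For the stick-breaking construction,
Sethuraman's recursion `Q = V δ_Y + (1 - V) Q'` turns into a linear equation for the second moment
of `Q(A) - m(A)`, with solution `m(A) (1 - m(A)) / (s + 1)`; taking `A` to be the whole space shows
that `Q` is almost surely a probability measure. Since `M + n → ∞` and the empirical frequency of
each atom converges by the strong law of large numbers, the posterior mass of each atom `y`
converges in `L¹` to `P₀{y}`. On a countable space the total variation distance between probability
measures is `∑ y, (P₀{y} - Q{y})⁺`, and its terms are dominated by `P₀{y}`, so convergence of the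
masses of the atoms suffices, as in Scheffé's lemma.
-/

namespace DirichletPosterior

open scoped Topology

/-! ### Moments, convergence in law and product measures -/

theorem integral_abs_le_sqrt_integral_sq {Ω : Type*} [MeasurableSpace Ω] {μ : Measure Ω}
    [IsProbabilityMeasure μ] {f : Ω → ℝ} (hf : MemLp f 2 μ) :
    ∫ ω, |f ω| ∂μ ≤ √(∫ ω, f ω ^ 2 ∂μ) := by
  refine Real.le_sqrt_of_sq_le ?_
  have h := variance_nonneg |f| μ
  rw [variance_eq_sub hf.abs] at h
  simp only [Pi.pow_apply, Pi.abs_apply, sq_abs] at h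
  linarith

theorem integral_abs_sub_integral_le_sqrt_variance {Ω : Type*} [MeasurableSpace Ω] {μ : Measure Ω}
    [IsProbabilityMeasure μ] {f : Ω → ℝ} (hf : MemLp f 2 μ) :
    ∫ ω, |f ω - ∫ ω', f ω' ∂μ| ∂μ ≤ √Var[f; μ] :=
  variance_eq_integral hf.aemeasurable ▸
    integral_abs_le_sqrt_integral_sq (hf.sub (memLp_const _))

theorem tendstoInDistribution_zero_of_tendsto_integral_norm {ι E : Type*} {l : Filter ι}
    [l.IsCountablyGenerated] {Ω : ι → Type*} [∀ i, MeasurableSpace (Ω i)]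
    {μ : ∀ i, Measure (Ω i)} [∀ i, IsProbabilityMeasure (μ i)]
    [NormedAddCommGroup E] [MeasurableSpace E] [BorelSpace E] {T : ∀ i, Ω i → E}
    (hT : ∀ i, Integrable (T i) (μ i)) (hlim : Tendsto (fun i => ∫ ω, ‖T i ω‖ ∂μ i) l (𝓝 0)) :
    TendstoInDistribution T l (fun _ : Unit => (0 : E)) μ (Measure.dirac ()) := by
  have hTm := fun i => (hT i).aestronglyMeasurable.aemeasurable
  refine ⟨hTm, by fun_prop, tendsto_iff_forall_lipschitz_integral_tendsto.2 ?_⟩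
  rintro f ⟨C, hC⟩ ⟨L, hL⟩
  have hf : Measurable f := hL.continuous.measurable
  have hfT : ∀ i, Integrable (fun ω => f (T i ω) - f 0) (μ i) := fun i =>
    .of_bound ((hf.comp_aemeasurable (hTm i)).sub_const _).aestronglyMeasurable C
      (ae_of_all _ fun ω => by simpa only [dist_eq_norm] using hC (T i ω) 0)
  have h_sub : ∀ i, ∫ ω, f (T i ω) ∂μ i - f 0 = ∫ ω, (f (T i ω) - f 0) ∂μ i := fun i => by
    have h := integral_add (hfT i) (integrable_const (f 0))
    simp only [sub_add_cancel, integral_const, probReal_univ, one_smul] at h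
    rw [h, add_sub_cancel_right]
  have h_le : ∀ i, ‖∫ ω, f (T i ω) ∂μ i - f 0‖ ≤ L * ∫ ω, ‖T i ω‖ ∂μ i := fun i => by
    rw [h_sub, ← integral_const_mul]
    refine norm_integral_le_of_norm_le ((hT i).norm.const_mul _) (ae_of_all _ fun ω => ?_)
    simpa only [dist_eq_norm, sub_zero] using hL.dist_le_mul (T i ω) 0
  change Tendsto (fun i => ∫ t, f t ∂((μ i).map (T i))) l
    (𝓝 (∫ t, f t ∂((Measure.dirac ()).map fun _ : Unit => (0 : E))))
  rw [integral_map measurable_const.aemeasurable hf.aestronglyMeasurable, integral_dirac]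
  simp only [integral_map (hTm _) hf.aestronglyMeasurable]
  exact tendsto_iff_norm_sub_tendsto_zero.2 (squeeze_zero (fun _ => norm_nonneg _) h_le
    (by simpa using hlim.const_mul (L : ℝ)))

theorem measurePreserving_head_tail {Ω : Type*} [MeasurableSpace Ω] (μ : Measure Ω)
    [IsProbabilityMeasure μ] :
    MeasurePreserving (fun x : ℕ → Ω => (x 0, fun i => x (i + 1)))
      (Measure.infinitePi fun _ => μ) (μ.prod (Measure.infinitePi fun _ => μ)) := by
  refine ⟨by fun_prop, ?_⟩
  have h_indep : IndepFun (fun x : ℕ → Ω => x 0) (fun x i => x (i + 1))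
      (Measure.infinitePi fun _ => μ) := by
    have h := indep_iSup_of_disjoint (fun i => (measurable_pi_apply i).comap_le)
      (iIndepFun_infinitePi (P := fun _ : ℕ => μ) (X := fun _ x => x) fun _ => measurable_id)
      (S := {0}) (T := {0}ᶜ) disjoint_compl_right
    refine indep_of_indep_of_le_left (indep_of_indep_of_le_right h ?_) ?_
    · rw [MeasurableSpace.pi, MeasurableSpace.comap_iSup]
      refine iSup_le fun i => ?_
      rw [MeasurableSpace.comap_comp]
      exact le_iSup₂_of_le (i + 1) (by simp) le_rfl
    · exact le_iSup₂_of_le 0 rfl le_rfl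
  rw [(indepFun_iff_map_prod_eq_prod_map_map (measurable_pi_apply 0).aemeasurable
    (Measurable.aemeasurable (by fun_prop))).1 h_indep, Measure.infinitePi_map_eval]
  congr 1
  exact Measure.map_infinitePi_infinitePi_of_inj (P := fun _ => μ) (add_left_injective 1)

theorem measurePreserving_prodProdProdComm {Ω₁ Ω₂ Ω₃ Ω₄ : Type*} [MeasurableSpace Ω₁]
    [MeasurableSpace Ω₂] [MeasurableSpace Ω₃] [MeasurableSpace Ω₄] (μ₁ : Measure Ω₁)
    (μ₂ : Measure Ω₂) (μ₃ : Measure Ω₃) (μ₄ : Measure Ω₄) [SFinite μ₁] [SFinite μ₂] [SFinite μ₃]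
    [SFinite μ₄] :
    MeasurePreserving (Equiv.prodProdProdComm Ω₁ Ω₂ Ω₃ Ω₄) ((μ₁.prod μ₂).prod (μ₃.prod μ₄))
      ((μ₁.prod μ₃).prod (μ₂.prod μ₄)) := by
  have h_middle : MeasurePreserving (fun p : Ω₂ × Ω₃ × Ω₄ => (p.2.1, p.1, p.2.2))
      (μ₂.prod (μ₃.prod μ₄)) (μ₃.prod (μ₂.prod μ₄)) :=
    (measurePreserving_prodAssoc μ₃ μ₂ μ₄).comp
      ((Measure.measurePreserving_swap.prod (MeasurePreserving.id μ₄)).comp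
        (measurePreserving_prodAssoc μ₂ μ₃ μ₄).symm)
  exact (measurePreserving_prodAssoc μ₁ μ₃ (μ₂.prod μ₄)).symm.comp
    (((MeasurePreserving.id μ₁).prod h_middle).comp (measurePreserving_prodAssoc μ₁ μ₂ _))

theorem measurePreserving_head_tail_prod {Ω Ω' : Type*} [MeasurableSpace Ω] [MeasurableSpace Ω']
    (μ : Measure Ω) (ν : Measure Ω') [IsProbabilityMeasure μ] [IsProbabilityMeasure ν] :
    MeasurePreserving
      (fun p : (ℕ → Ω) × (ℕ → Ω') =>
        ((p.1 0, p.2 0), ((fun i => p.1 (i + 1)), fun i => p.2 (i + 1))))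
      ((Measure.infinitePi fun _ => μ).prod (Measure.infinitePi fun _ => ν))
      ((μ.prod ν).prod ((Measure.infinitePi fun _ => μ).prod (Measure.infinitePi fun _ => ν))) :=
  (measurePreserving_prodProdProdComm _ _ _ _).comp
    ((measurePreserving_head_tail μ).prod (measurePreserving_head_tail ν))

theorem integral_sq_add_mul_prod {Ω Ω' : Type*} [MeasurableSpace Ω] [MeasurableSpace Ω']
    {μ : Measure Ω} {ν : Measure Ω'} [SFinite μ] [IsProbabilityMeasure ν] {u w : Ω → ℝ}
    {f : Ω' → ℝ} (hu : MemLp u 2 μ) (hw : MemLp w 2 μ) (hf : MemLp f 2 ν)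
    (huw : ∫ ω, u ω * w ω ∂μ = 0) :
    ∫ z, (u z.1 + w z.1 * f z.2) ^ 2 ∂(μ.prod ν) =
      ∫ ω, u ω ^ 2 ∂μ + (∫ ω, w ω ^ 2 ∂μ) * ∫ ω, f ω ^ 2 ∂ν := by
  have h_uu : Integrable (fun z : Ω × Ω' => u z.1 ^ 2) (μ.prod ν) := hu.integrable_sq.comp_fst ν
  have h_ww : Integrable (fun z : Ω × Ω' => w z.1 ^ 2 * f z.2 ^ 2) (μ.prod ν) :=
    hw.integrable_sq.mul_prod hf.integrable_sq
  have h_uw : Integrable (fun z : Ω × Ω' => u z.1 * w z.1 * (2 * f z.2)) (μ.prod ν) :=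
    (hu.integrable_mul hw).mul_prod ((hf.integrable one_le_two).const_mul 2)
  have h_expand : ∀ z : Ω × Ω', (u z.1 + w z.1 * f z.2) ^ 2 =
      u z.1 ^ 2 + w z.1 ^ 2 * f z.2 ^ 2 + u z.1 * w z.1 * (2 * f z.2) := fun z => by ring
  simp only [h_expand]
  rw [integral_add (f := fun z : Ω × Ω' => u z.1 ^ 2 + w z.1 ^ 2 * f z.2 ^ 2)
      (h_uu.add h_ww) h_uw, integral_add h_uu h_ww, integral_fun_fst (fun ω => u ω ^ 2),
    integral_prod_mul (fun ω => w ω ^ 2) fun ω => f ω ^ 2,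
    integral_prod_mul (fun ω => u ω * w ω) fun ω => 2 * f ω, huw, probReal_univ, one_smul,
    zero_mul, add_zero]

/-! ### Gamma and beta distributions -/

section WeightedDensity

variable {Ω : Type*} [MeasurableSpace Ω] {μ : Measure Ω} {p q φ : Ω → ℝ} {c : ℝ}

theorem integral_mul_withDensity_ofReal (hp : Measurable p) (hp₀ : 0 ≤ p) (hq : Measurable q)
    (hq₀ : 0 ≤ q) (h : ∀ ω, p ω * φ ω = c * q ω) (g : Ω → ℝ) :
    ∫ ω, φ ω * g ω ∂(μ.withDensity fun ω => ENNReal.ofReal (p ω)) =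
      c * ∫ ω, g ω ∂(μ.withDensity fun ω => ENNReal.ofReal (q ω)) := by
  rw [integral_withDensity_eq_integral_toReal_smul hp.ennreal_ofReal
      (ae_of_all _ fun _ => ENNReal.ofReal_lt_top),
    integral_withDensity_eq_integral_toReal_smul hq.ennreal_ofReal
      (ae_of_all _ fun _ => ENNReal.ofReal_lt_top), ← integral_const_mul]
  refine integral_congr_ae (ae_of_all _ fun ω => ?_)
  simp only [ENNReal.toReal_ofReal (hp₀ ω), ENNReal.toReal_ofReal (hq₀ ω), smul_eq_mul]
  rw [← mul_assoc, h, mul_assoc]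

theorem integrable_mul_withDensity_ofReal (hp : Measurable p) (hp₀ : 0 ≤ p) (hq : Measurable q)
    (hq₀ : 0 ≤ q) (h : ∀ ω, p ω * φ ω = c * q ω) {g : Ω → ℝ}
    (hg : Integrable g (μ.withDensity fun ω => ENNReal.ofReal (q ω))) :
    Integrable (fun ω => φ ω * g ω) (μ.withDensity fun ω => ENNReal.ofReal (p ω)) := by
  rw [integrable_withDensity_iff_integrable_smul' hp.ennreal_ofReal
    (ae_of_all _ fun _ => ENNReal.ofReal_lt_top)]
  rw [integrable_withDensity_iff_integrable_smul' hq.ennreal_ofReal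
    (ae_of_all _ fun _ => ENNReal.ofReal_lt_top)] at hg
  refine (hg.const_mul c).congr (ae_of_all _ fun ω => ?_)
  simp only [ENNReal.toReal_ofReal (hp₀ ω), ENNReal.toReal_ofReal (hq₀ ω), smul_eq_mul]
  rw [← mul_assoc, ← h, mul_assoc]

end WeightedDensity

theorem gammaPDFReal_mul_self {a r : ℝ} (ha : 0 < a) (hr : 0 < r) (x : ℝ) :
    gammaPDFReal a r x * x = a / r * gammaPDFReal (a + 1) r x := by
  rcases lt_trichotomy x 0 with hx | rfl | hx
  · simp [gammaPDFReal, hx.not_ge]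
  · simp [gammaPDFReal, ha.ne']
  · have hΓ := (Real.Gamma_pos_of_pos ha).ne'
    simp only [gammaPDFReal, if_pos hx.le, Real.Gamma_add_one ha.ne', add_sub_cancel_right,
      Real.rpow_add_one hr.ne', Real.rpow_sub_one hx.ne']
    field_simp

theorem integral_mul_gammaMeasure {a r : ℝ} (ha : 0 < a) (hr : 0 < r) (g : ℝ → ℝ) :
    ∫ x, x * g x ∂(gammaMeasure a r) = a / r * ∫ x, g x ∂(gammaMeasure (a + 1) r) :=
  integral_mul_withDensity_ofReal (measurable_gammaPDFReal a r) (gammaPDFReal_nonneg ha hr)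
    (measurable_gammaPDFReal _ r) (gammaPDFReal_nonneg (by positivity) hr)
    (gammaPDFReal_mul_self ha hr) g

theorem integrable_mul_gammaMeasure {a r : ℝ} (ha : 0 < a) (hr : 0 < r) {g : ℝ → ℝ}
    (hg : Integrable g (gammaMeasure (a + 1) r)) :
    Integrable (fun x => x * g x) (gammaMeasure a r) :=
  integrable_mul_withDensity_ofReal (measurable_gammaPDFReal a r) (gammaPDFReal_nonneg ha hr)
    (measurable_gammaPDFReal _ r) (gammaPDFReal_nonneg (by positivity) hr)
    (gammaPDFReal_mul_self ha hr) hg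

theorem integrable_id_gammaMeasure {a r : ℝ} (ha : 0 < a) (hr : 0 < r) :
    Integrable (fun x => x) (gammaMeasure a r) := by
  have := isProbabilityMeasure_gammaMeasure (add_pos ha one_pos) hr
  simpa only [mul_one] using integrable_mul_gammaMeasure ha hr (integrable_const (1 : ℝ))

theorem memLp_two_id_gammaMeasure {a r : ℝ} (ha : 0 < a) (hr : 0 < r) :
    MemLp id 2 (gammaMeasure a r) := by
  rw [memLp_two_iff_integrable_sq measurable_id.aestronglyMeasurable]
  simpa only [id_eq, ← sq] using
    integrable_mul_gammaMeasure ha hr (integrable_id_gammaMeasure (add_pos ha one_pos) hr)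

theorem integral_id_gammaMeasure {a r : ℝ} (ha : 0 < a) (hr : 0 < r) :
    ∫ x, x ∂(gammaMeasure a r) = a / r := by
  have := isProbabilityMeasure_gammaMeasure (add_pos ha one_pos) hr
  simpa using integral_mul_gammaMeasure ha hr fun _ => 1

theorem variance_id_gammaMeasure {a r : ℝ} (ha : 0 < a) (hr : 0 < r) :
    Var[id; gammaMeasure a r] = a / r ^ 2 := by
  have := isProbabilityMeasure_gammaMeasure ha hr
  have h_sq : ∫ x, x ^ 2 ∂(gammaMeasure a r) = a / r * ((a + 1) / r) := by
    simp only [sq, integral_mul_gammaMeasure ha hr,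
      integral_id_gammaMeasure (add_pos ha one_pos) hr]
  rw [variance_eq_sub (memLp_two_id_gammaMeasure ha hr)]
  simp only [Pi.pow_apply, id_eq, h_sq, integral_id_gammaMeasure ha hr]
  field_simp
  ring

theorem ae_nonneg_gammaMeasure (a r : ℝ) : ∀ᵐ x ∂(gammaMeasure a r), 0 ≤ x := by
  refine (ae_withDensity_iff (measurable_gammaPDFReal a r).ennreal_ofReal).2
    (ae_of_all _ fun x hx => ?_)
  contrapose! hx
  exact gammaPDF_of_neg hx

theorem betaPDFReal_nonneg {a b : ℝ} (ha : 0 < a) (hb : 0 < b) (x : ℝ) :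
    0 ≤ betaPDFReal a b x := by
  by_cases hx : 0 < x ∧ x < 1
  · exact (betaPDFReal_pos hx.1 hx.2 ha hb).le
  · exact (if_neg hx).ge

theorem betaPDFReal_mul_self {a b : ℝ} (ha : 0 < a) (hb : 0 < b) (x : ℝ) :
    betaPDFReal a b x * x = a / (a + b) * betaPDFReal (a + 1) b x := by
  simp only [betaPDFReal, beta]
  split_ifs with hx
  · have hΓa := (Real.Gamma_pos_of_pos ha).ne'
    have hΓb := (Real.Gamma_pos_of_pos hb).ne'
    have hΓab := (Real.Gamma_pos_of_pos (add_pos ha hb)).ne'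
    rw [add_right_comm a 1 b, Real.Gamma_add_one ha.ne', Real.Gamma_add_one (add_pos ha hb).ne',
      add_sub_cancel_right, Real.rpow_sub_one hx.1.ne']
    have := hx.1.ne'
    field_simp
  · simp

theorem betaPDFReal_one_sub (a b x : ℝ) : betaPDFReal a b (1 - x) = betaPDFReal b a x := by
  simp only [betaPDFReal, beta, sub_pos, sub_lt_self_iff, sub_sub_cancel, and_comm (a := x < 1),
    add_comm b, mul_comm (Real.Gamma b), mul_right_comm _ (x ^ (b - 1))]

theorem integral_mul_betaMeasure {a b : ℝ} (ha : 0 < a) (hb : 0 < b) (g : ℝ → ℝ) :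
    ∫ x, x * g x ∂(betaMeasure a b) = a / (a + b) * ∫ x, g x ∂(betaMeasure (a + 1) b) :=
  integral_mul_withDensity_ofReal (measurable_betaPDFReal a b) (betaPDFReal_nonneg ha hb)
    (measurable_betaPDFReal _ b) (betaPDFReal_nonneg (by positivity) hb)
    (betaPDFReal_mul_self ha hb) g

theorem integral_sq_betaMeasure {a b : ℝ} (ha : 0 < a) (hb : 0 < b) :
    ∫ x, x ^ 2 ∂(betaMeasure a b) = a / (a + b) * ((a + 1) / (a + 1 + b)) := by
  have := isProbabilityMeasureBeta (add_pos (add_pos ha one_pos) one_pos) hb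
  have h := integral_mul_betaMeasure (add_pos ha one_pos) hb fun _ => 1
  simp only [mul_one, integral_const, probReal_univ, smul_eq_mul] at h
  simp only [sq, integral_mul_betaMeasure ha hb, h]

theorem integral_one_sub_betaMeasure {a b : ℝ} (ha : 0 < a) (hb : 0 < b) (g : ℝ → ℝ) :
    ∫ x, g (1 - x) ∂(betaMeasure a b) = ∫ x, g x ∂(betaMeasure b a) := by
  have h_density : ∀ {a b : ℝ}, 0 < a → 0 < b → ∀ g : ℝ → ℝ,
      ∫ x, g x ∂(betaMeasure a b) = ∫ x, betaPDFReal a b x * g x := fun {a b} ha hb g => by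
    rw [betaMeasure]
    refine (integral_withDensity_eq_integral_toReal_smul
      (measurable_betaPDFReal a b).ennreal_ofReal
      (ae_of_all _ fun _ => ENNReal.ofReal_lt_top) g).trans ?_
    simp only [ENNReal.toReal_ofReal (betaPDFReal_nonneg ha hb _), smul_eq_mul]
  rw [h_density ha hb, h_density hb ha,
    ← integral_sub_left_eq_self (fun x => betaPDFReal b a x * g x) volume 1]
  simp only [betaPDFReal_one_sub]

theorem ae_mem_Icc_betaMeasure (a b : ℝ) :
    ∀ᵐ x ∂(betaMeasure a b), x ∈ Set.Icc (0 : ℝ) 1 := by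
  refine (ae_withDensity_iff (measurable_betaPDFReal a b).ennreal_ofReal).2
    (ae_of_all _ fun x hx => ?_)
  by_contra h
  rcases not_and_or.1 h with h | h
  · exact hx (betaPDF_eq_zero_of_nonpos (not_le.1 h).le)
  · exact hx (betaPDF_eq_zero_of_one_le (not_le.1 h).le)

/-! ### Dirichlet distributions and Dirichlet processes -/

theorem gammaLaw_of_pos {a : ℝ} (ha : 0 < a) : gammaLaw a = gammaMeasure a 1 := if_neg ha.ne'

theorem gammaLaw_zero : gammaLaw 0 = Measure.dirac 0 := if_pos rfl

theorem isProbabilityMeasure_gammaLaw {a : ℝ} (ha : 0 ≤ a) : IsProbabilityMeasure (gammaLaw a) := by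
  rcases ha.eq_or_lt with rfl | ha
  · rw [gammaLaw_zero]
    infer_instance
  · rw [gammaLaw_of_pos ha]
    exact isProbabilityMeasure_gammaMeasure ha one_pos

theorem ae_nonneg_gammaLaw {a : ℝ} (ha : 0 ≤ a) : ∀ᵐ x ∂(gammaLaw a), 0 ≤ x := by
  rcases ha.eq_or_lt with rfl | ha
  · simp [gammaLaw_zero]
  · exact gammaLaw_of_pos ha ▸ ae_nonneg_gammaMeasure a 1

theorem memLp_two_id_gammaLaw {a : ℝ} (ha : 0 ≤ a) : MemLp id 2 (gammaLaw a) := by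
  rcases ha.eq_or_lt with rfl | ha
  · rw [gammaLaw_zero, memLp_two_iff_integrable_sq measurable_id.aestronglyMeasurable]
    exact integrable_dirac enorm_lt_top
  · exact gammaLaw_of_pos ha ▸ memLp_two_id_gammaMeasure ha one_pos

theorem integral_id_gammaLaw {a : ℝ} (ha : 0 ≤ a) : ∫ x, x ∂(gammaLaw a) = a := by
  rcases ha.eq_or_lt with rfl | ha
  · simp [gammaLaw_zero]
  · rw [gammaLaw_of_pos ha, integral_id_gammaMeasure ha one_pos, div_one]

theorem variance_id_gammaLaw {a : ℝ} (ha : 0 ≤ a) : Var[id; gammaLaw a] = a := by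
  rcases ha.eq_or_lt with rfl | ha
  · simp [gammaLaw_zero]
  · rw [gammaLaw_of_pos ha, variance_id_gammaMeasure ha one_pos, one_pow, div_one]

theorem abs_div_sum_sub_div_le {ι : Type*} [Fintype ι] {g : ι → ℝ} (hg : ∀ i, 0 ≤ g i) {s : ℝ}
    (hs : 0 < s) (i : ι) (a : ℝ) :
    |g i / ∑ j, g j - a / s| ≤ (|g i - a| + |∑ j, g j - s|) / s := by
  have h_le : g i ≤ ∑ j, g j := Finset.single_le_sum (fun j _ => hg j) (Finset.mem_univ i)
  generalize ∑ j, g j = S at h_le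
  have h_ratio : |g i / S| ≤ 1 := by
    rw [abs_of_nonneg (div_nonneg (hg i) ((hg i).trans h_le))]
    exact div_le_one_of_le₀ h_le ((hg i).trans h_le)
  have h_eq : g i / S - a / s = ((g i - a) - g i / S * (S - s)) / s := by
    rcases eq_or_ne S 0 with rfl | hS
    · simp [le_antisymm h_le (hg i), neg_div]
    · field_simp
      ring
  rw [h_eq, abs_div, abs_of_pos hs]
  gcongr
  refine (abs_sub _ _).trans ?_
  rw [abs_mul]
  gcongr
  exact mul_le_of_le_one_left (abs_nonneg _) h_ratio

section GammaProduct

variable {ι : Type*} [Fintype ι] {a : ι → ℝ}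

theorem ae_pi_gammaLaw_nonneg (ha : ∀ i, 0 ≤ a i) :
    ∀ᵐ g ∂(Measure.pi fun i => gammaLaw (a i)), ∀ i, 0 ≤ g i := by
  have := fun i => isProbabilityMeasure_gammaLaw (ha i)
  exact ae_all_iff.2 fun i =>
    (Measure.quasiMeasurePreserving_eval _ i).ae (ae_nonneg_gammaLaw (ha i))

theorem memLp_two_eval_pi_gammaLaw (ha : ∀ i, 0 ≤ a i) (i : ι) :
    MemLp (fun g : ι → ℝ => g i) 2 (Measure.pi fun i => gammaLaw (a i)) := by
  have := fun i => isProbabilityMeasure_gammaLaw (ha i)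
  exact (memLp_two_id_gammaLaw (ha i)).comp_measurePreserving (measurePreserving_eval _ i)

theorem integral_eval_pi_gammaLaw (ha : ∀ i, 0 ≤ a i) (i : ι) :
    ∫ g : ι → ℝ, g i ∂(Measure.pi fun i => gammaLaw (a i)) = a i := by
  have := fun i => isProbabilityMeasure_gammaLaw (ha i)
  rw [integral_comp_eval (μ := fun i => gammaLaw (a i)) (f := fun x : ℝ => x)
    measurable_id.aestronglyMeasurable, integral_id_gammaLaw (ha i)]

theorem integral_abs_eval_sub_pi_gammaLaw_le (ha : ∀ i, 0 ≤ a i) (i : ι) :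
    ∫ g : ι → ℝ, |g i - a i| ∂(Measure.pi fun i => gammaLaw (a i)) ≤ √(a i) := by
  have := fun i => isProbabilityMeasure_gammaLaw (ha i)
  have h := integral_abs_sub_integral_le_sqrt_variance (memLp_two_id_gammaLaw (ha i))
  simp only [id_eq, integral_id_gammaLaw (ha i), variance_id_gammaLaw (ha i)] at h
  rwa [integral_comp_eval (μ := fun i => gammaLaw (a i)) (f := fun x : ℝ => |x - a i|)
    (Continuous.aestronglyMeasurable (by fun_prop))]

theorem integral_abs_sum_sub_pi_gammaLaw_le (ha : ∀ i, 0 ≤ a i) :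
    ∫ g : ι → ℝ, |∑ i, g i - ∑ i, a i| ∂(Measure.pi fun i => gammaLaw (a i)) ≤ √(∑ i, a i) := by
  have := fun i => isProbabilityMeasure_gammaLaw (ha i)
  have h_var := variance_sum_pi fun i => memLp_two_id_gammaLaw (ha i)
  simp only [variance_id_gammaLaw (ha _), id_eq] at h_var
  have h := integral_abs_sub_integral_le_sqrt_variance
    (memLp_finsetSum Finset.univ fun i _ => memLp_two_eval_pi_gammaLaw ha i)
  rwa [integral_finsetSum _ fun i _ => (memLp_two_eval_pi_gammaLaw ha i).integrable one_le_two,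
    ← Finset.sum_fn, h_var, Finset.sum_congr rfl fun i _ => integral_eval_pi_gammaLaw ha i] at h

end GammaProduct

theorem integral_abs_eval_sub_dirichletDist_le {k : ℕ} {a : Fin k → ℝ} (ha : ∀ i, 0 ≤ a i)
    (hs : 0 < ∑ i, a i) (i : Fin k) :
    ∫ v, |v i - a i / ∑ j, a j| ∂(dirichletDist a) ≤ 2 / √(∑ j, a j) := by
  have := fun i => isProbabilityMeasure_gammaLaw (ha i)
  have h_int : Integrable (fun g : Fin k → ℝ => |g i - a i|) (Measure.pi fun i => gammaLaw (a i)) :=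
    (((memLp_two_eval_pi_gammaLaw ha i).integrable one_le_two).sub (integrable_const _)).abs
  have h_int_sum : Integrable (fun g : Fin k → ℝ => |∑ j, g j - ∑ j, a j|)
      (Measure.pi fun i => gammaLaw (a i)) :=
    ((integrable_finsetSum _ fun j _ => (memLp_two_eval_pi_gammaLaw ha j).integrable
      one_le_two).sub (integrable_const _)).abs
  rw [dirichletDist, integral_map (Measurable.aemeasurable (by fun_prop))
    (Continuous.aestronglyMeasurable (by fun_prop))]
  calc ∫ g : Fin k → ℝ, |g i / ∑ j, g j - a i / ∑ j, a j| ∂(Measure.pi fun i => gammaLaw (a i))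
      ≤ ∫ g : Fin k → ℝ, (|g i - a i| + |∑ j, g j - ∑ j, a j|) / ∑ j, a j
          ∂(Measure.pi fun i => gammaLaw (a i)) := by
        refine integral_mono_of_nonneg (ae_of_all _ fun _ => abs_nonneg _)
          ((h_int.add h_int_sum).div_const _) ?_
        filter_upwards [ae_pi_gammaLaw_nonneg ha] with g hg
        exact abs_div_sum_sub_div_le hg hs i (a i)
    _ ≤ (√(∑ j, a j) + √(∑ j, a j)) / ∑ j, a j := by
        rw [integral_div, integral_add h_int h_int_sum]
        gcongr
        · exact (integral_abs_eval_sub_pi_gammaLaw_le ha i).trans (Real.sqrt_le_sqrt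
            (Finset.single_le_sum (fun j _ => ha j) (Finset.mem_univ i)))
        · exact integral_abs_sum_sub_pi_gammaLaw_le ha
    _ = 2 / √(∑ j, a j) := by
        rw [← two_mul, mul_div_assoc, Real.sqrt_div_self', mul_one_div]

variable {X : Type*} [MeasurableSpace X]

theorem measurable_measureReal {A : Set X} (hA : MeasurableSet A) :
    Measurable fun Q : Measure X => Q.real A :=
  (Measure.measurable_coe hA).ennreal_toReal

theorem IsDirichletProcess.map_real {m : Measure X} {s : ℝ} {D : Measure (Measure X)}
    (hD : IsDirichletProcess m s D) {A : Set X} (hA : MeasurableSet A) :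
    D.map (fun Q => Q.real A) =
      (dirichletDist ![s * m.real A, s * m.real Aᶜ]).map fun v => v 0 := by
  have hB : ∀ i, MeasurableSet ((![A, Aᶜ] : Fin 2 → Set X) i) := by
    simp [Fin.forall_fin_two, hA]
  have h := hD.map_partition 2 ![A, Aᶜ] hB
    (by simp [Pairwise, Fin.forall_fin_two, disjoint_compl_right, disjoint_compl_left])
    (Set.eq_univ_of_forall fun x => by simp [em])
  have h_params : (fun i => s * m.real ((![A, Aᶜ] : Fin 2 → Set X) i)) =
      ![s * m.real A, s * m.real Aᶜ] := by
    ext i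
    fin_cases i <;> rfl
  rw [← h_params, ← h, Measure.map_map (measurable_pi_apply 0)
    (measurable_pi_lambda _ fun i => measurable_measureReal (hB i))]
  rfl

theorem IsDirichletProcess.integral_abs_sub_le {m : Measure X} [IsProbabilityMeasure m] {s : ℝ}
    (hs : 0 < s) {D : Measure (Measure X)} (hD : IsDirichletProcess m s D) {A : Set X}
    (hA : MeasurableSet A) :
    ∫ Q, |Q.real A - m.real A| ∂D ≤ 2 / √s := by
  have h_sum : ∑ i, (![s * m.real A, s * m.real Aᶜ] : Fin 2 → ℝ) i = s := by
    simp [Fin.sum_univ_two, probReal_compl_eq_one_sub hA, ← mul_add]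
  have h_nonneg : ∀ i, 0 ≤ (![s * m.real A, s * m.real Aᶜ] : Fin 2 → ℝ) i := by
    simp [Fin.forall_fin_two, hs.le, mul_nonneg]
  have h := integral_abs_eval_sub_dirichletDist_le h_nonneg (h_sum.symm ▸ hs) 0
  rw [h_sum, Matrix.cons_val_zero, mul_div_cancel_left₀ _ hs.ne'] at h
  have h_cont : Continuous fun t : ℝ => |t - m.real A| := by fun_prop
  rwa [← integral_map (measurable_measureReal hA).aemeasurable h_cont.aestronglyMeasurable,
    hD.map_real hA, integral_map (measurable_pi_apply 0).aemeasurable h_cont.aestronglyMeasurable]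

/-! ### Stick-breaking -/

theorem stickWeight_succ (v : ℕ → ℝ) (i : ℕ) :
    stickWeight v (i + 1) = (1 - v 0) * stickWeight (fun j => v (j + 1)) i := by
  rw [stickWeight, stickWeight, Finset.prod_range_succ']
  ring

theorem stickWeight_nonneg {v : ℕ → ℝ} (hv : ∀ i, v i ∈ Set.Icc (0 : ℝ) 1) (i : ℕ) :
    0 ≤ stickWeight v i :=
  mul_nonneg (hv i).1 (Finset.prod_nonneg fun j _ => sub_nonneg.2 (hv j).2)

theorem sum_range_stickWeight (v : ℕ → ℝ) (N : ℕ) :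
    ∑ i ∈ Finset.range N, stickWeight v i = 1 - ∏ j ∈ Finset.range N, (1 - v j) := by
  induction N with
  | zero => simp
  | succ N ih =>
    rw [Finset.sum_range_succ, ih, Finset.prod_range_succ, stickWeight]
    ring

theorem stickMeasure_eq_add {v : ℕ → ℝ} (hv : v 0 ≤ 1) (y : ℕ → X) :
    stickMeasure (v, y) = ENNReal.ofReal (v 0) • Measure.dirac (y 0) +
      ENNReal.ofReal (1 - v 0) • stickMeasure ((fun i => v (i + 1)), fun i => y (i + 1)) := by
  ext A hA
  simp only [stickMeasure, Measure.sum_apply _ hA, Measure.add_apply, Measure.smul_apply,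
    smul_eq_mul, ← ENNReal.tsum_mul_left]
  rw [tsum_eq_zero_add' ENNReal.summable]
  simp only [stickWeight_succ, ENNReal.ofReal_mul (sub_nonneg.2 hv), mul_assoc]
  simp [stickWeight]

theorem stickMeasure_univ_le_one {v : ℕ → ℝ} (hv : ∀ i, v i ∈ Set.Icc (0 : ℝ) 1) (y : ℕ → X) :
    stickMeasure (v, y) Set.univ ≤ 1 := by
  simp only [stickMeasure, Measure.sum_apply _ MeasurableSet.univ, Measure.smul_apply,
    smul_eq_mul, measure_univ, mul_one]
  refine ENNReal.tsum_le_of_sum_range_le fun N => ?_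
  rw [← ENNReal.ofReal_sum_of_nonneg fun i _ => stickWeight_nonneg hv i, sum_range_stickWeight,
    ENNReal.ofReal_le_one]
  exact sub_le_self _ (Finset.prod_nonneg fun j _ => sub_nonneg.2 (hv j).2)

theorem stickMeasure_real_le_one {v : ℕ → ℝ} (hv : ∀ i, v i ∈ Set.Icc (0 : ℝ) 1) (y : ℕ → X)
    (A : Set X) : (stickMeasure (v, y)).real A ≤ 1 :=
  ENNReal.toReal_le_of_le_ofReal zero_le_one
    (((measure_mono A.subset_univ).trans (stickMeasure_univ_le_one hv y)).trans_eq
      ENNReal.ofReal_one.symm)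

theorem stickMeasure_real_eq {v : ℕ → ℝ} (hv : ∀ i, v i ∈ Set.Icc (0 : ℝ) 1) (y : ℕ → X)
    {A : Set X} (hA : MeasurableSet A) :
    (stickMeasure (v, y)).real A = v 0 * A.indicator 1 (y 0) +
      (1 - v 0) * (stickMeasure ((fun i => v (i + 1)), fun i => y (i + 1))).real A := by
  have : IsFiniteMeasure (stickMeasure ((fun i => v (i + 1)), fun i => y (i + 1))) :=
    ⟨(stickMeasure_univ_le_one (fun i => hv (i + 1)) _).trans_lt ENNReal.one_lt_top⟩
  have h_dirac : (Measure.dirac (y 0)).real A = A.indicator 1 (y 0) := by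
    by_cases h : y 0 ∈ A <;> simp [measureReal_def, Measure.dirac_apply' _ hA, h]
  rw [stickMeasure_eq_add (hv 0).2, measureReal_def, Measure.add_apply, Measure.smul_apply,
    Measure.smul_apply, smul_eq_mul, smul_eq_mul, ENNReal.toReal_add (by finiteness)
    (by finiteness), ENNReal.toReal_mul, ENNReal.toReal_mul, ENNReal.toReal_ofReal (hv 0).1,
    ENNReal.toReal_ofReal (sub_nonneg.2 (hv 0).2), ← measureReal_def, ← measureReal_def, h_dirac]

/-- Joint law of an i.i.d. sequence of stick proportions with law `β` and an independent i.i.d.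
sequence of atoms with law `m`. -/
noncomputable abbrev stickSequenceLaw (β : Measure ℝ) (m : Measure X) :
    Measure ((ℕ → ℝ) × (ℕ → X)) :=
  (Measure.infinitePi fun _ => β).prod (Measure.infinitePi fun _ => m)

theorem integral_indicator_sub_measureReal (m : Measure X) [IsProbabilityMeasure m] {A : Set X}
    (hA : MeasurableSet A) : ∫ y, (A.indicator 1 y - m.real A) ∂m = 0 := by
  have h_ind : Integrable (A.indicator (1 : X → ℝ)) m := (integrable_const 1).indicator hA
  rw [integral_sub h_ind (integrable_const _), integral_indicator_one hA]
  simp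

theorem integral_sq_indicator_sub_measureReal (m : Measure X) [IsProbabilityMeasure m] {A : Set X}
    (hA : MeasurableSet A) :
    ∫ y, (A.indicator 1 y - m.real A) ^ 2 ∂m = m.real A * (1 - m.real A) := by
  have h_ind : Integrable (A.indicator (1 : X → ℝ)) m := (integrable_const 1).indicator hA
  have h_expand : ∀ y, (A.indicator 1 y - m.real A) ^ 2 =
      (1 - 2 * m.real A) * A.indicator 1 y + m.real A ^ 2 := fun y => by
    by_cases hy : y ∈ A
    · simp only [hy, Set.indicator_of_mem, Pi.one_apply]
      ring
    · simp [hy]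
  simp only [h_expand]
  rw [integral_add (h_ind.const_mul _) (integrable_const _), integral_const_mul,
    integral_indicator_one hA, integral_const, probReal_univ, one_smul]
  ring

theorem ae_mem_Icc_stickSequenceLaw {β : Measure ℝ} [IsProbabilityMeasure β]
    (hβ : ∀ᵐ v ∂β, v ∈ Set.Icc (0 : ℝ) 1) (m : Measure X) :
    ∀ᵐ p ∂(stickSequenceLaw β m), ∀ i, p.1 i ∈ Set.Icc (0 : ℝ) 1 :=
  Measure.quasiMeasurePreserving_fst.ae (ae_all_iff.2 fun i =>
    (measurePreserving_eval_infinitePi (fun _ => β) i).quasiMeasurePreserving.ae hβ)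

section StickSequence

variable {β : Measure ℝ} [IsProbabilityMeasure β] {A : Set X}

theorem memLp_two_stickMeasure_real_sub (hβ : ∀ᵐ v ∂β, v ∈ Set.Icc (0 : ℝ) 1)
    (m : Measure X) [IsProbabilityMeasure m] (hA : MeasurableSet A) (c : ℝ) :
    MemLp (fun p => (stickMeasure p).real A - c) 2 (stickSequenceLaw β m) := by
  have h_meas : Measurable fun p : (ℕ → ℝ) × (ℕ → X) => (stickMeasure p).real A :=
    (measurable_measureReal hA).comp measurable_stickMeasure
  refine .sub (.of_bound h_meas.aestronglyMeasurable 1 ?_) (memLp_const c)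
  filter_upwards [ae_mem_Icc_stickSequenceLaw hβ m] with p hp
  rw [Real.norm_of_nonneg measureReal_nonneg]
  exact stickMeasure_real_le_one hp p.2 A

theorem memLp_two_mul_indicator_sub (hβ : ∀ᵐ v ∂β, v ∈ Set.Icc (0 : ℝ) 1)
    (m : Measure X) [IsProbabilityMeasure m] (hA : MeasurableSet A) :
    MemLp (fun z : ℝ × X => z.1 * (A.indicator 1 z.2 - m.real A)) 2 (β.prod m) := by
  have h_meas : Measurable fun z : ℝ × X => z.1 * (A.indicator 1 z.2 - m.real A) :=
    measurable_fst.mul (((measurable_one.indicator hA).comp measurable_snd).sub_const _)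
  refine .of_bound h_meas.aestronglyMeasurable 1 ?_
  filter_upwards [Measure.quasiMeasurePreserving_fst.ae hβ] with z hz
  rw [norm_mul, Real.norm_of_nonneg hz.1]
  refine mul_le_one₀ hz.2 (norm_nonneg _)
    (Real.dist_le_of_mem_Icc_01 ?_ ⟨measureReal_nonneg, measureReal_le_one⟩)
  by_cases h : z.2 ∈ A <;> simp [h]

/-- Sethuraman's distributional recursion `D = V δ_Y + (1 - V) D'`, evaluated at `A`. -/
theorem integral_comp_stickMeasure_real (hβ : ∀ᵐ v ∂β, v ∈ Set.Icc (0 : ℝ) 1)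
    (m : Measure X) [IsProbabilityMeasure m] (hA : MeasurableSet A) {g : ℝ → ℝ}
    (hg : Measurable g) :
    ∫ p, g ((stickMeasure p).real A) ∂(stickSequenceLaw β m) =
      ∫ z, g (z.1.1 * A.indicator 1 z.1.2 + (1 - z.1.1) * (stickMeasure z.2).real A)
        ∂((β.prod m).prod (stickSequenceLaw β m)) := by
  have h_eval : Measurable fun p : (ℕ → ℝ) × (ℕ → X) => (stickMeasure p).real A :=
    (measurable_measureReal hA).comp measurable_stickMeasure
  have h_ind : Measurable (A.indicator (1 : X → ℝ)) := measurable_one.indicator hA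
  have h_meas : Measurable fun z : (ℝ × X) × ((ℕ → ℝ) × (ℕ → X)) =>
      g (z.1.1 * A.indicator 1 z.1.2 + (1 - z.1.1) * (stickMeasure z.2).real A) :=
    hg.comp ((measurable_fst.fst.mul (h_ind.comp measurable_fst.snd)).add
      ((measurable_fst.fst.const_sub 1).mul (h_eval.comp measurable_snd)))
  have h_split := measurePreserving_head_tail_prod β m
  rw [← h_split.map_eq, integral_map h_split.aemeasurable h_meas.aestronglyMeasurable]
  refine integral_congr_ae ?_
  filter_upwards [ae_mem_Icc_stickSequenceLaw hβ m] with p hp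
  rw [← stickMeasure_real_eq hp p.2 hA]

theorem integral_sq_stickMeasure_real_sub (hβ : ∀ᵐ v ∂β, v ∈ Set.Icc (0 : ℝ) 1)
    (m : Measure X) [IsProbabilityMeasure m] (hA : MeasurableSet A) :
    ∫ p, ((stickMeasure p).real A - m.real A) ^ 2 ∂(stickSequenceLaw β m) =
      (∫ v, v ^ 2 ∂β) * (m.real A * (1 - m.real A)) +
        (∫ v, (1 - v) ^ 2 ∂β) *
          ∫ p, ((stickMeasure p).real A - m.real A) ^ 2 ∂(stickSequenceLaw β m) := by
  have h_cross : ∫ z : ℝ × X, z.1 * (A.indicator 1 z.2 - m.real A) * (1 - z.1) ∂(β.prod m) = 0 := by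
    have h := integral_prod_mul (μ := β) (ν := m) (fun v : ℝ => v * (1 - v))
      fun y => A.indicator 1 y - m.real A
    simpa only [integral_indicator_sub_measureReal m hA, mul_zero, mul_right_comm] using h
  have h_one_sub : MemLp (fun z : ℝ × X => 1 - z.1) 2 (β.prod m) := by
    refine .of_bound (measurable_fst.const_sub 1).aestronglyMeasurable 1 ?_
    filter_upwards [Measure.quasiMeasurePreserving_fst.ae hβ] with z hz
    exact Real.dist_le_of_mem_Icc_01 (by simp) hz
  have h_centre : ∀ v i q : ℝ, v * i + (1 - v) * q - m.real A =
      v * (i - m.real A) + (1 - v) * (q - m.real A) := fun v i q => by ring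
  have h_recursion := integral_comp_stickMeasure_real hβ m hA
    (g := fun t => (t - m.real A) ^ 2) (by fun_prop)
  simp only [h_centre] at h_recursion
  refine h_recursion.trans ?_
  rw [integral_sq_add_mul_prod (memLp_two_mul_indicator_sub hβ m hA) h_one_sub
    (memLp_two_stickMeasure_real_sub hβ m hA (m.real A)) h_cross]
  simp only [mul_pow]
  rw [integral_prod_mul (fun v : ℝ => v ^ 2) fun y => (A.indicator 1 y - m.real A) ^ 2,
    integral_sq_indicator_sub_measureReal m hA, integral_fun_fst (fun v : ℝ => (1 - v) ^ 2),
    probReal_univ, one_smul]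

end StickSequence

section StickBreakingLaw

variable {s : ℝ} {A : Set X}

theorem memLp_two_measureReal_sub_stickBreakingLaw (hs : 0 < s) (m : Measure X)
    [IsProbabilityMeasure m] (hA : MeasurableSet A) (c : ℝ) :
    MemLp (fun Q : Measure X => Q.real A - c) 2 (stickBreakingLaw m s) := by
  have := isProbabilityMeasureBeta one_pos hs
  exact (memLp_map_measure_iff ((measurable_measureReal hA).sub_const c).aestronglyMeasurable
    measurable_stickMeasure.aemeasurable).2
      (memLp_two_stickMeasure_real_sub (ae_mem_Icc_betaMeasure 1 s) m hA c)

theorem integral_sq_measureReal_sub_stickBreakingLaw (hs : 0 < s) (m : Measure X)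
    [IsProbabilityMeasure m] (hA : MeasurableSet A) :
    ∫ Q, (Q.real A - m.real A) ^ 2 ∂(stickBreakingLaw m s) =
      m.real A * (1 - m.real A) / (s + 1) := by
  have := isProbabilityMeasureBeta one_pos hs
  have h_meas : Measurable fun Q : Measure X => (Q.real A - m.real A) ^ 2 :=
    ((measurable_measureReal hA).sub_const _).pow_const 2
  rw [stickBreakingLaw, integral_map measurable_stickMeasure.aemeasurable
    h_meas.aestronglyMeasurable]
  have h_recursion := integral_sq_stickMeasure_real_sub (ae_mem_Icc_betaMeasure 1 s) m hA
  rw [integral_one_sub_betaMeasure one_pos hs fun v => v ^ 2, integral_sq_betaMeasure hs one_pos,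
    integral_sq_betaMeasure one_pos hs] at h_recursion
  generalize ∫ p, ((stickMeasure p).real A - m.real A) ^ 2
    ∂(stickSequenceLaw (betaMeasure 1 s) m) = I at h_recursion ⊢
  field_simp at h_recursion ⊢
  exact mul_left_cancel₀ (by positivity : s + 2 ≠ 0) (by linear_combination h_recursion / 2)

theorem integral_abs_measureReal_sub_stickBreakingLaw_le (hs : 0 < s) (m : Measure X)
    [IsProbabilityMeasure m] (hA : MeasurableSet A) :
    ∫ Q, |Q.real A - m.real A| ∂(stickBreakingLaw m s) ≤ 2 / √s := by
  have := isProbabilityMeasure_stickBreakingLaw m hs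
  refine (integral_abs_le_sqrt_integral_sq
    (memLp_two_measureReal_sub_stickBreakingLaw hs m hA _)).trans ?_
  have h_le_one : m.real A * (1 - m.real A) ≤ 1 :=
    mul_le_one₀ measureReal_le_one (sub_nonneg.2 measureReal_le_one)
      (sub_le_self _ measureReal_nonneg)
  rw [integral_sq_measureReal_sub_stickBreakingLaw hs m hA]
  calc √(m.real A * (1 - m.real A) / (s + 1)) ≤ √(1 / s) := by
        gcongr
        exact le_add_of_nonneg_right zero_le_one
    _ = 1 / √s := by rw [Real.sqrt_div zero_le_one, Real.sqrt_one]
    _ ≤ 2 / √s := by gcongr; exact one_le_two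

end StickBreakingLaw

theorem ae_isProbabilityMeasure_stickBreakingLaw {s : ℝ} (hs : 0 < s) (m : Measure X)
    [IsProbabilityMeasure m] : ∀ᵐ Q ∂(stickBreakingLaw m s), IsProbabilityMeasure Q := by
  have h_sq := integral_sq_measureReal_sub_stickBreakingLaw hs m MeasurableSet.univ
  rw [probReal_univ, sub_self, mul_zero, zero_div, integral_eq_zero_iff_of_nonneg
    (fun _ => sq_nonneg _)
    (memLp_two_measureReal_sub_stickBreakingLaw hs m MeasurableSet.univ 1).integrable_sq] at h_sq
  filter_upwards [h_sq] with Q hQ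
  refine ⟨(ENNReal.toReal_eq_one_iff _).1 (sub_eq_zero.1 (pow_eq_zero_iff two_ne_zero |>.1 hQ))⟩

/-! ### Total variation distance -/

theorem abs_measureReal_sub_le_add_univ (Q P : Measure X) [IsFiniteMeasure Q]
    [IsFiniteMeasure P] (C : Set X) :
    |Q.real C - P.real C| ≤ Q.real .univ + P.real .univ := by
  refine (abs_sub _ _).trans ?_
  rw [abs_of_nonneg measureReal_nonneg, abs_of_nonneg measureReal_nonneg]
  exact add_le_add (measureReal_mono C.subset_univ) (measureReal_mono C.subset_univ)

theorem bddAbove_range_abs_measureReal_sub (Q P : Measure X) [IsFiniteMeasure Q]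
    [IsFiniteMeasure P] : BddAbove (Set.range fun C : Set X => |Q.real C - P.real C|) :=
  ⟨_, Set.forall_mem_range.2 (abs_measureReal_sub_le_add_univ Q P)⟩

theorem tvDist_le_add_univ (Q P : Measure X) [IsFiniteMeasure Q] [IsFiniteMeasure P] :
    tvDist Q P ≤ Q.real .univ + P.real .univ :=
  ciSup_le (abs_measureReal_sub_le_add_univ Q P)

theorem tvDist_nonneg (Q P : Measure X) : 0 ≤ tvDist Q P :=
  Real.iSup_nonneg fun _ => abs_nonneg _

theorem tvDist_comm (Q P : Measure X) : tvDist Q P = tvDist P Q := by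
  simp only [tvDist, abs_sub_comm]

theorem tvDist_triangle (Q P R : Measure X) [IsFiniteMeasure Q] [IsFiniteMeasure P]
    [IsFiniteMeasure R] : tvDist Q R ≤ tvDist Q P + tvDist P R :=
  ciSup_le fun C => (abs_sub_le _ (P.real C) _).trans (add_le_add
    (le_ciSup (bddAbove_range_abs_measureReal_sub Q P) C)
    (le_ciSup (bddAbove_range_abs_measureReal_sub P R) C))

theorem integrable_measureReal {D : Measure (Measure X)} [IsFiniteMeasure D]
    (hD : ∀ᵐ Q ∂D, IsProbabilityMeasure Q) {A : Set X} (hA : MeasurableSet A) :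
    Integrable (fun Q : Measure X => Q.real A) D := by
  refine .of_bound (measurable_measureReal hA).aestronglyMeasurable 1 ?_
  filter_upwards [hD] with Q hQ
  rw [Real.norm_of_nonneg measureReal_nonneg]
  exact measureReal_le_one

section Countable

variable [Countable X] [MeasurableSingletonClass X]

theorem hasSum_indicator_measureReal_singleton (Q : Measure X) [IsFiniteMeasure Q] (C : Set X) :
    HasSum (C.indicator fun y => Q.real {y}) (Q.real C) := by
  have h_tsum := Q.tsum_indicator_apply_singleton C C.to_countable.measurableSet
  have h_ne_top : ∑' y, C.indicator (fun y => Q {y}) y ≠ ∞ := h_tsum ▸ measure_ne_top Q C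
  have h_indicator : (C.indicator fun y => Q.real {y}) =
      fun y => (C.indicator (fun y => Q {y}) y).toReal :=
    Set.indicator_comp_of_zero ENNReal.toReal_zero
  rw [h_indicator, measureReal_def, ← h_tsum,
    ENNReal.tsum_toReal_eq (ENNReal.ne_top_of_tsum_ne_top h_ne_top)]
  exact ENNReal.hasSum_toReal h_ne_top

theorem summable_measureReal_singleton (Q : Measure X) [IsFiniteMeasure Q] :
    Summable fun y => Q.real {y} := by
  simpa only [Set.indicator_univ] using (hasSum_indicator_measureReal_singleton Q .univ).summable

theorem summable_posPart_measureReal_singleton_sub (Q P : Measure X) [IsFiniteMeasure Q] :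
    Summable fun y => (Q.real {y} - P.real {y})⁺ :=
  .of_nonneg_of_le (fun _ => posPart_nonneg _)
    (fun _ => sup_le (sub_le_self _ measureReal_nonneg) measureReal_nonneg)
    (summable_measureReal_singleton Q)

theorem hasSum_indicator_measureReal_singleton_sub (Q P : Measure X) [IsFiniteMeasure Q]
    [IsFiniteMeasure P] (C : Set X) :
    HasSum (C.indicator fun y => Q.real {y} - P.real {y}) (Q.real C - P.real C) := by
  rw [Set.indicator_sub]
  exact (hasSum_indicator_measureReal_singleton Q C).sub
    (hasSum_indicator_measureReal_singleton P C)

theorem measureReal_sub_le_tsum_posPart (Q P : Measure X) [IsFiniteMeasure Q] [IsFiniteMeasure P]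
    (C : Set X) : Q.real C - P.real C ≤ ∑' y, (Q.real {y} - P.real {y})⁺ :=
  hasSum_le (fun _ => Set.indicator_apply_le' (fun _ => le_posPart _) fun _ => posPart_nonneg _)
    (hasSum_indicator_measureReal_singleton_sub Q P C)
    (summable_posPart_measureReal_singleton_sub Q P).hasSum

/-- The Hahn decomposition: `Q - P` is largest on the set where it is positive pointwise. -/
theorem tsum_posPart_le_tvDist (Q P : Measure X) [IsFiniteMeasure Q] [IsFiniteMeasure P] :
    ∑' y, (Q.real {y} - P.real {y})⁺ ≤ tvDist Q P := by
  have h_posPart : (fun y => (Q.real {y} - P.real {y})⁺) =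
      {y | 0 ≤ Q.real {y} - P.real {y}}.indicator fun y => Q.real {y} - P.real {y} := by
    ext y
    rw [Set.indicator_apply]
    split_ifs with hy
    · exact posPart_of_nonneg hy
    · exact posPart_of_nonpos (le_of_not_ge hy)
  rw [h_posPart, (hasSum_indicator_measureReal_singleton_sub Q P _).tsum_eq]
  exact (le_abs_self _).trans (le_ciSup (bddAbove_range_abs_measureReal_sub Q P) _)

theorem tvDist_eq_max_tsum_posPart (Q P : Measure X) [IsFiniteMeasure Q] [IsFiniteMeasure P] :
    tvDist Q P =
      max (∑' y, (Q.real {y} - P.real {y})⁺) (∑' y, (P.real {y} - Q.real {y})⁺) := by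
  refine le_antisymm (ciSup_le fun C => abs_le'.2 ⟨?_, ?_⟩)
    (max_le (tsum_posPart_le_tvDist Q P) (tvDist_comm Q P ▸ tsum_posPart_le_tvDist P Q))
  · exact le_max_of_le_left (measureReal_sub_le_tsum_posPart Q P C)
  · exact le_max_of_le_right (neg_sub (Q.real C) _ ▸ measureReal_sub_le_tsum_posPart P Q C)

theorem tvDist_eq_tsum_posPart {Q P : Measure X} [IsFiniteMeasure Q] [IsFiniteMeasure P]
    (h : Q.real .univ = P.real .univ) : tvDist Q P = ∑' y, (Q.real {y} - P.real {y})⁺ := by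
  have h_sub : ∑' y, (Q.real {y} - P.real {y})⁺ - ∑' y, (P.real {y} - Q.real {y})⁺ = 0 := by
    rw [← (summable_posPart_measureReal_singleton_sub Q P).tsum_sub
      (summable_posPart_measureReal_singleton_sub P Q), ← sub_eq_zero.2 h,
      ← (hasSum_indicator_measureReal_singleton_sub Q P .univ).tsum_eq]
    refine tsum_congr fun y => ?_
    rw [← neg_sub (Q.real {y}), posPart_neg, posPart_sub_negPart, Set.indicator_univ]
  rw [tvDist_eq_max_tsum_posPart, ← sub_eq_zero.1 h_sub, max_self]

theorem aemeasurable_tvDist {D : Measure (Measure X)} (hD : ∀ᵐ Q ∂D, IsFiniteMeasure Q)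
    (P : Measure X) [IsFiniteMeasure P] : AEMeasurable (fun Q => tvDist Q P) D := by
  have h_meas : ∀ y : X, Measurable fun Q : Measure X => Q.real {y} := fun y =>
    measurable_measureReal (measurableSet_singleton y)
  refine ⟨fun Q => max (∑' y, (Q.real {y} - P.real {y})⁺) (∑' y, (P.real {y} - Q.real {y})⁺),
    (Measurable.tsum fun y => ?_).max (Measurable.tsum fun y => ?_), ?_⟩
  · exact ((h_meas y).sub_const _).max measurable_const
  · exact ((h_meas y).const_sub _).max measurable_const
  · filter_upwards [hD] with Q hQ using tvDist_eq_max_tsum_posPart Q P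

theorem integrable_tvDist {D : Measure (Measure X)} [IsFiniteMeasure D]
    (hD : ∀ᵐ Q ∂D, IsProbabilityMeasure Q) (P : Measure X) [IsFiniteMeasure P] :
    Integrable (fun Q => tvDist Q P) D := by
  have hD_finite : ∀ᵐ Q ∂D, IsFiniteMeasure Q := hD.mono fun Q hQ => inferInstance
  refine .of_bound (aemeasurable_tvDist hD_finite P).aestronglyMeasurable (1 + P.real .univ) ?_
  filter_upwards [hD] with Q hQ
  rw [Real.norm_of_nonneg (tvDist_nonneg Q P), ← probReal_univ (μ := Q)]
  exact tvDist_le_add_univ Q P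

theorem tendsto_tvDist_of_tendsto_singleton {ι : Type*} {l : Filter ι} {Q : ι → Measure X}
    {P : Measure X} [IsProbabilityMeasure P] (hQ : ∀ᶠ i in l, IsProbabilityMeasure (Q i))
    (h : ∀ y, Tendsto (fun i => (Q i).real {y}) l (𝓝 (P.real {y}))) :
    Tendsto (fun i => tvDist P (Q i)) l (𝓝 0) := by
  have h_term : ∀ y, Tendsto (fun i => (P.real {y} - (Q i).real {y})⁺) l (𝓝 0) := fun y => by
    simpa only [Function.comp_def, sub_self, posPart_zero] using
      (continuous_posPart.tendsto _).comp ((h y).const_sub (P.real {y}))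
  have h_tsum := tendsto_tsum_of_dominated_convergence (summable_measureReal_singleton P) h_term
    (Eventually.of_forall fun i y => ?_)
  · rw [tsum_zero] at h_tsum
    refine h_tsum.congr' ?_
    filter_upwards [hQ] with i hi
    exact (tvDist_eq_tsum_posPart (by simp only [probReal_univ])).symm
  · rw [Real.norm_of_nonneg (posPart_nonneg _)]
    exact sup_le (sub_le_self _ measureReal_nonneg) measureReal_nonneg

theorem tendsto_integral_tvDist_of_tendsto_singleton {ι : Type*} {l : Filter ι}
    {D : ι → Measure (Measure X)} [∀ i, IsProbabilityMeasure (D i)] {P : Measure X}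
    [IsProbabilityMeasure P] (hD : ∀ i, ∀ᵐ Q ∂D i, IsProbabilityMeasure Q)
    (h : ∀ y, Tendsto (fun i => ∫ Q, |Q.real {y} - P.real {y}| ∂D i) l (𝓝 0)) :
    Tendsto (fun i => ∫ Q, tvDist P Q ∂D i) l (𝓝 0) := by
  have h_diff : ∀ i y, Integrable (fun Q : Measure X => P.real {y} - Q.real {y}) (D i) :=
    fun i y => (integrable_const _).sub
      (integrable_measureReal (hD i) (measurableSet_singleton y))
  have h_posPart : ∀ i y, Integrable (fun Q : Measure X => (P.real {y} - Q.real {y})⁺) (D i) :=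
    fun i y => (h_diff i y).pos_part
  have h_bound : ∀ i y, ∫ Q, (P.real {y} - Q.real {y})⁺ ∂D i ≤ P.real {y} := fun i y => by
    refine (integral_mono (h_posPart i y) (integrable_const (P.real {y})) fun Q =>
      sup_le (sub_le_self _ measureReal_nonneg) measureReal_nonneg).trans_eq ?_
    rw [integral_const, probReal_univ, one_smul]
  have h_nonneg : ∀ i y, 0 ≤ ∫ Q, (P.real {y} - Q.real {y})⁺ ∂D i := fun i y =>
    integral_nonneg fun Q => posPart_nonneg _
  have h_term : ∀ y, Tendsto (fun i => ∫ Q, (P.real {y} - Q.real {y})⁺ ∂D i) l (𝓝 0) :=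
    fun y => squeeze_zero (h_nonneg · y) (fun i => by
      simp only [abs_sub_comm _ (P.real {y})]
      exact integral_mono (h_posPart i y) (h_diff i y).abs fun Q =>
        sup_le (le_abs_self _) (abs_nonneg _)) (h y)
  have h_tsum := tendsto_tsum_of_dominated_convergence (summable_measureReal_singleton P) h_term
    (Eventually.of_forall fun i y => (Real.norm_of_nonneg (h_nonneg i y)).trans_le (h_bound i y))
  rw [tsum_zero] at h_tsum
  refine h_tsum.congr fun i => ?_
  rw [integral_tsum_of_summable_integral_norm (h_posPart i)]
  · refine integral_congr_ae ?_
    filter_upwards [hD i] with Q hQ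
    exact (tvDist_eq_tsum_posPart (by simp only [probReal_univ])).symm
  · simp only [Real.norm_of_nonneg (posPart_nonneg _)]
    exact .of_nonneg_of_le (h_nonneg i) (h_bound i) (summable_measureReal_singleton P)

end Countable

/-! ### Empirical measures and posterior consistency -/

theorem theta_mem_Icc {M : ℝ} (hM : 0 < M) (n : ℕ) : theta M n ∈ Set.Icc (0 : ℝ) 1 :=
  ⟨by unfold theta; positivity,
    div_le_one_of_le₀ (le_add_of_nonneg_right n.cast_nonneg) (by positivity)⟩

theorem tendsto_theta (M : ℝ) : Tendsto (theta M) atTop (𝓝 0) :=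
  tendsto_const_nhds.div_atTop
    (tendsto_atTop_add_const_left _ M tendsto_natCast_atTop_atTop)

theorem isProbabilityMeasure_empirical (x : ℕ → X) {n : ℕ} (hn : n ≠ 0) :
    IsProbabilityMeasure (empirical x n) :=
  ⟨by simp [empirical, ENNReal.inv_mul_cancel, hn]⟩

instance isFiniteMeasure_empirical (x : ℕ → X) (n : ℕ) : IsFiniteMeasure (empirical x n) := by
  rcases eq_or_ne n 0 with rfl | hn
  · simp only [empirical, Finset.range_zero, Finset.sum_empty, smul_zero]
    infer_instance
  · have := isProbabilityMeasure_empirical x hn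
    infer_instance

theorem empirical_real (x : ℕ → X) (n : ℕ) {A : Set X} (hA : MeasurableSet A) :
    (empirical x n).real A = (∑ i ∈ Finset.range n, A.indicator 1 (x i)) / n := by
  have h_dirac : ∀ i, (Measure.dirac (x i) A).toReal = A.indicator 1 (x i) := fun i => by
    rw [Measure.dirac_apply' _ hA]
    by_cases h : x i ∈ A <;> simp [h]
  rw [empirical, measureReal_ennreal_smul_apply, measureReal_def, Measure.finsetSum_apply,
    ENNReal.toReal_sum fun i _ => measure_ne_top _ _, div_eq_inv_mul, ENNReal.toReal_inv,
    ENNReal.toReal_natCast]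
  simp only [h_dirac]

theorem ae_tendsto_empirical (P : Measure X) [IsProbabilityMeasure P] {A : Set X}
    (hA : MeasurableSet A) :
    ∀ᵐ x ∂(Measure.infinitePi fun _ : ℕ => P),
      Tendsto (fun n => (empirical x n).real A) atTop (𝓝 (P.real A)) := by
  have h_ind : Measurable (A.indicator (1 : X → ℝ)) := measurable_one.indicator hA
  have h_eval := measurePreserving_eval_infinitePi fun _ : ℕ => P
  have h_int : Integrable (fun x : ℕ → X => A.indicator (1 : X → ℝ) (x 0))
      (Measure.infinitePi fun _ => P) :=
    (h_eval 0).integrable_comp_of_integrable ((integrable_const 1).indicator hA)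
  have h_indep : iIndepFun (fun i (x : ℕ → X) => A.indicator (1 : X → ℝ) (x i))
      (Measure.infinitePi fun _ => P) := iIndepFun_infinitePi fun _ => h_ind
  have h_ident : ∀ i, IdentDistrib (fun x : ℕ → X => A.indicator (1 : X → ℝ) (x i))
      (fun x => A.indicator 1 (x 0)) (Measure.infinitePi fun _ => P)
      (Measure.infinitePi fun _ => P) := fun i =>
    .comp ⟨(h_eval i).aemeasurable, (h_eval 0).aemeasurable,
      (h_eval i).map_eq.trans (h_eval 0).map_eq.symm⟩ h_ind
  have h_mean : ∫ x : ℕ → X, A.indicator (1 : X → ℝ) (x 0) ∂(Measure.infinitePi fun _ => P) =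
      P.real A := by
    rw [← integral_indicator_one hA]
    conv_rhs => rw [← (h_eval 0).map_eq]
    exact (integral_map (h_eval 0).aemeasurable h_ind.aestronglyMeasurable).symm
  filter_upwards [strong_law_ae_real _ h_int (fun i j hij => h_indep.indepFun hij) h_ident]
    with x hx
  simpa only [empirical_real x _ hA, h_mean] using hx

theorem posteriorMean_real (α : Measure X) [IsFiniteMeasure α] {M : ℝ} (hM : 0 < M) (x : ℕ → X)
    (n : ℕ) (A : Set X) :
    (posteriorMean α M x n).real A =
      theta M n * α.real A + (1 - theta M n) * (empirical x n).real A := by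
  obtain ⟨h_nonneg, h_le_one⟩ := theta_mem_Icc hM n
  have := Measure.smul_finite α (ENNReal.ofReal_ne_top (r := theta M n))
  have := Measure.smul_finite (empirical x n) (ENNReal.ofReal_ne_top (r := 1 - theta M n))
  rw [posteriorMean, measureReal_add_apply, measureReal_ennreal_smul_apply,
    measureReal_ennreal_smul_apply, ENNReal.toReal_ofReal h_nonneg,
    ENNReal.toReal_ofReal (sub_nonneg.2 h_le_one)]

theorem tendsto_posteriorMean_real (α : Measure X) [IsFiniteMeasure α] {M : ℝ} (hM : 0 < M)
    {x : ℕ → X} {A : Set X} {p : ℝ}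
    (hx : Tendsto (fun n => (empirical x n).real A) atTop (𝓝 p)) :
    Tendsto (fun n => (posteriorMean α M x n).real A) atTop (𝓝 p) := by
  have h := ((tendsto_theta M).mul_const (α.real A)).add
    (((tendsto_theta M).const_sub 1).mul hx)
  simpa only [posteriorMean_real α hM, zero_mul, sub_zero, one_mul, zero_add] using h

section Consistency

variable [Countable X] [MeasurableSingletonClass X] {x : ℕ → X} {P : Measure X}
  [IsProbabilityMeasure P] {Post : ℕ → ProbabilityMeasure (Measure X)}

theorem tvTendstoZeroInLaw_of_tendsto_singleton
    (hx : ∀ y, Tendsto (fun n => (empirical x n).real {y}) atTop (𝓝 (P.real {y})))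
    (hPost : ∀ n, ∀ᵐ Q ∂(Post n : Measure (Measure X)), IsProbabilityMeasure Q)
    (h : ∀ y, Tendsto (fun n => ∫ Q, |Q.real {y} - P.real {y}| ∂(Post n : Measure (Measure X)))
      atTop (𝓝 0)) :
    TVTendstoZeroInLaw x Post := by
  have h_int := fun n => integrable_tvDist (hPost n) (empirical x n)
  have h_int_P : ∀ n, Integrable (fun Q => tvDist P Q) (Post n : Measure (Measure X)) := fun n =>
    (integrable_tvDist (hPost n) P).congr (ae_of_all _ fun Q => tvDist_comm Q P)
  have h_triangle : ∀ n, ∫ Q, tvDist Q (empirical x n) ∂(Post n : Measure (Measure X)) ≤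
      ∫ Q, tvDist P Q ∂(Post n : Measure (Measure X)) + tvDist P (empirical x n) := fun n => by
    have h_const := integrable_const (μ := (Post n : Measure (Measure X)))
      (tvDist P (empirical x n))
    have h_le := integral_mono_ae (h_int n) ((h_int_P n).add h_const) <|
      (hPost n).mono fun Q hQ => (tvDist_triangle Q P _).trans_eq (by rw [tvDist_comm Q P]; rfl)
    rwa [integral_add' (h_int_P n) h_const, integral_const, probReal_univ, one_smul] at h_le
  have h_empirical : Tendsto (fun n => tvDist P (empirical x n)) atTop (𝓝 0) :=
    tendsto_tvDist_of_tendsto_singleton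
      ((eventually_ne_atTop 0).mono fun n hn => isProbabilityMeasure_empirical x hn) hx
  have h_lim := (tendsto_integral_tvDist_of_tendsto_singleton hPost h).add h_empirical
  rw [add_zero] at h_lim
  refine tendstoInDistribution_zero_of_tendsto_integral_norm h_int ?_
  simp only [Real.norm_of_nonneg (tvDist_nonneg _ _)]
  exact squeeze_zero (fun n => integral_nonneg fun Q => tvDist_nonneg _ _) h_triangle h_lim

theorem tvTendstoZeroInLaw_of_integral_abs_sub_posteriorMean_le (α : Measure X)
    [IsFiniteMeasure α] {M : ℝ} (hM : 0 < M)
    (hx : ∀ y, Tendsto (fun n => (empirical x n).real {y}) atTop (𝓝 (P.real {y})))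
    (hPost : ∀ n, ∀ᵐ Q ∂(Post n : Measure (Measure X)), IsProbabilityMeasure Q)
    (h : ∀ n y, ∫ Q, |Q.real {y} - (posteriorMean α M x n).real {y}|
      ∂(Post n : Measure (Measure X)) ≤ 2 / √(M + n)) :
    TVTendstoZeroInLaw x Post := by
  refine tvTendstoZeroInLaw_of_tendsto_singleton hx hPost fun y => ?_
  have h_le : ∀ n, ∫ Q, |Q.real {y} - P.real {y}| ∂(Post n : Measure (Measure X)) ≤
      2 / √(M + n) + |(posteriorMean α M x n).real {y} - P.real {y}| := fun n => by
    have h_eval := integrable_measureReal (hPost n) (measurableSet_singleton y)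
    have h_abs := (h_eval.sub (integrable_const ((posteriorMean α M x n).real {y}))).abs
    have h_const := integrable_const (μ := (Post n : Measure (Measure X)))
      |(posteriorMean α M x n).real {y} - P.real {y}|
    have h_mono := integral_mono (h_eval.sub (integrable_const (P.real {y}))).abs
      (h_abs.add h_const) fun Q => abs_sub_le _ ((posteriorMean α M x n).real {y}) _
    rw [integral_add' h_abs h_const, integral_const, probReal_univ, one_smul] at h_mono
    exact h_mono.trans (add_le_add_left (h n y) _)
  have h_rate : Tendsto (fun n : ℕ => 2 / √(M + n)) atTop (𝓝 0) :=
    tendsto_const_nhds.div_atTop (Real.tendsto_sqrt_atTop.comp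
      (tendsto_atTop_add_const_left _ M tendsto_natCast_atTop_atTop))
  have h_mean := ((tendsto_posteriorMean_real α hM (hx y)).sub_const (P.real {y})).abs
  have h_lim := h_rate.add h_mean
  rw [sub_self, abs_zero, add_zero] at h_lim
  exact squeeze_zero (fun n => integral_nonneg fun Q => abs_nonneg _) h_le h_lim

end Consistency

end DirichletPosterior

/-- Posterior consistency of the Dirichlet process prior in total variation, on a countable space,
for almost every i.i.d. data sequence `x`. The posterior is `DP(α_{x_1,…,x_n}, M + n)`; the
convergence is asserted for every sequence of laws with the defining finite-dimensional
distributions, and for the laws given by the stick-breaking representation. -/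
theorem mainTheorem4 {X : Type*} [Countable X] [MeasurableSpace X] [MeasurableSingletonClass X]
    (α P₀ : MeasureTheory.ProbabilityMeasure X) (M : ℝ) (hM : 0 < M) :
    ∀ᵐ x ∂(MeasureTheory.Measure.infinitePi fun _ : ℕ => (P₀ : MeasureTheory.Measure X)),
      (∀ Post : ℕ → MeasureTheory.ProbabilityMeasure (MeasureTheory.Measure X),
        (∀ n, DirichletPosterior.IsDirichletProcess
          (DirichletPosterior.posteriorMean (α : MeasureTheory.Measure X) M x n) (M + n)
          (Post n : MeasureTheory.Measure (MeasureTheory.Measure X))) →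
        DirichletPosterior.TVTendstoZeroInLaw x Post) ∧
      DirichletPosterior.TVTendstoZeroInLaw x
        (DirichletPosterior.stickBreakingPosterior α M hM x) := by
  have hs : ∀ n : ℕ, 0 < M + n := fun n => by positivity
  have h_mean := DirichletPosterior.isProbabilityMeasure_posteriorMean (α : Measure X) hM
  have h_singleton := ae_all_iff.2 fun y : X =>
    DirichletPosterior.ae_tendsto_empirical (P₀ : Measure X) (measurableSet_singleton y)
  filter_upwards [h_singleton] with x hx
  refine ⟨fun Post hPost => ?_, ?_⟩
  · exact DirichletPosterior.tvTendstoZeroInLaw_of_integral_abs_sub_posteriorMean_le α hM hx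
      (fun n => (hPost n).ae_isProbabilityMeasure)
      fun n y => (hPost n).integral_abs_sub_le (hs n) (measurableSet_singleton y)
  · exact DirichletPosterior.tvTendstoZeroInLaw_of_integral_abs_sub_posteriorMean_le α hM hx
      (fun n => DirichletPosterior.ae_isProbabilityMeasure_stickBreakingLaw (hs n) _)
      fun n y => DirichletPosterior.integral_abs_measureReal_sub_stickBreakingLaw_le (hs n) _
        (measurableSet_singleton y)
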